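/- Let $t>\sqrt2$, and let $\beta=\beta(t)$ be the unique real number with $$1=\int_0^t \frac{u e^{-\beta u}}{1+e^{-\beta u}}\,du .$$ For $n\ge 1$ put $x=x_n=e^{-\beta/\sqrt n}$, and let $P_{x,n}$ be the probability measure on the set of all partitions $\lambda$ into distinct parts (of any size, the empty partition included) whose parts are all at most $t\sqrt n$, given by $$P_{x,n}(\lambda)=\frac{x^{|\lambda|}}{\prod_{k\le t\sqrt n}(1+x^k)},$$ where $|\lambda|$ is the sum of the parts of $\lambda$. Let $N(\lambda)=\sum_{k\le t\sqrt n}kX_k(\lambda)=|\lambda|$, where $X_k(\lambda)\in\{0,1\}$ is the multiplicity of $k$ as a part of $\lambda$, and let $\sigma_n^2=\operatorname{Var}_{x,n}(N)$ be the variance of $N$ under $P_{x,n}$, with $\sigma_n\ge 0$. Then for every $v\in\mathbb R$, $$\lim_{n\to\infty}P_{x,n}\!\left(\frac{N-n}{\sigma_n}\le v\right)=\frac1{\sqrt{2\pi}}\int_{-\infty}^v e^{-u^2/2}\,du .$$ Moreover, as $n\to\infty$, $$P_{x,n}(N=n)\sim\frac{1}{\sqrt{2\pi}\,\sigma_n}.$$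 -/

import Mathlib

open Filter Topology MeasureTheory ProbabilityTheory
open scoped Asymptotics

noncomputable section

namespace DistinctParts

/-- The integrand `u e^{-y u} / (1 + e^{-y u})` of the equation that defines `β(t)`. -/
def integrand (y u : ℝ) : ℝ :=
  u * Real.exp (-(y * u)) / (1 + Real.exp (-(y * u)))

theorem continuous_integrand : Continuous (Function.uncurry integrand) := by
  unfold Function.uncurry integrand
  refine Continuous.div (by fun_prop) (by fun_prop) fun p => ?_
  positivity

theorem integrand_eq (y u : ℝ) : integrand y u = u / (1 + Real.exp (y * u)) := by
  unfold integrand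
  rw [Real.exp_neg]
  have := Real.exp_pos (y * u)
  field_simp
  ring

theorem continuous_integrand_right (y : ℝ) : Continuous (integrand y) :=
  continuous_integrand.comp (by fun_prop : Continuous fun u : ℝ => (y, u))

/-- For every `t > √2` the equation `1 = ∫₀ᵗ u e^{-y u} / (1 + e^{-y u}) du` has exactly one real
solution `y`. -/
theorem existsUnique_beta {t : ℝ} (ht : √2 < t) :
    ∃! y : ℝ, 1 = ∫ u in (0 : ℝ)..t, integrand y u := by
  have ht0 : 0 < t := lt_of_le_of_lt (Real.sqrt_nonneg 2) ht
  have ht2 : 2 < t ^ 2 := (Real.sqrt_lt' ht0).1 ht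
  have hint (y : ℝ) : IntervalIntegrable (integrand y) volume 0 t :=
    (continuous_integrand_right y).intervalIntegrable _ _
  have hcont : Continuous fun y => ∫ u in (0 : ℝ)..t, integrand y u :=
    intervalIntegral.continuous_parametric_intervalIntegral_of_continuous' continuous_integrand 0 t
  have hup : ∫ u in (0 : ℝ)..t, integrand t u ≤ 1 := by
    have h : ∫ u in (0 : ℝ)..t, integrand t u ≤ ∫ u in (0 : ℝ)..t, 1 / t := by
      refine intervalIntegral.integral_mono_on ht0.le (hint t) (by simp) fun u hu => ?_
      rw [integrand_eq, div_le_div_iff₀ (by positivity) ht0]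
      nlinarith [Real.add_one_le_exp (t * u)]
    refine h.trans (le_of_eq ?_)
    rw [intervalIntegral.integral_const]
    simp [ht0.ne']
  have hc : 0 < t / (t ^ 2 / 2 - 1) := div_pos ht0 (by linarith)
  obtain ⟨c, hcdef⟩ : ∃ c, c = t / (t ^ 2 / 2 - 1) := ⟨_, rfl⟩
  rw [← hcdef] at hc
  have hlow : 1 ≤ ∫ u in (0 : ℝ)..t, integrand (-c) u := by
    have h : ∫ u in (0 : ℝ)..t, (u - 1 / c) ≤ ∫ u in (0 : ℝ)..t, integrand (-c) u := by
      refine intervalIntegral.integral_mono_on ht0.le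
        ((by fun_prop : Continuous fun u : ℝ => u - 1 / c).intervalIntegrable _ _)
        (hint (-c)) fun u hu => ?_
      have hu0 : 0 ≤ u := hu.1
      have he := Real.exp_pos (c * u)
      have h1 : integrand (-c) u = u - u / (1 + Real.exp (c * u)) := by
        unfold integrand
        rw [show -(-c * u) = c * u by ring]
        field_simp
        ring
      have h2 : u / (1 + Real.exp (c * u)) ≤ 1 / c := by
        rw [div_le_div_iff₀ (by positivity) hc]
        nlinarith [Real.add_one_le_exp (c * u)]
      rw [h1]
      linarith
    refine le_trans (le_of_eq ?_) h
    rw [intervalIntegral.integral_sub (by simp) (by simp)]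
    have : t ^ 2 / 2 - 1 ≠ 0 := by linarith
    simp only [integral_id, intervalIntegral.integral_const, smul_eq_mul, hcdef]
    field_simp
    ring
  obtain ⟨y, hy⟩ : ∃ y, ∫ u in (0 : ℝ)..t, integrand y u = 1 :=
    mem_range_of_exists_le_of_exists_ge hcont ⟨t, hup⟩ ⟨-c, hlow⟩
  have hanti : StrictAnti fun y => ∫ u in (0 : ℝ)..t, integrand y u := by
    intro a b hab
    refine intervalIntegral.integral_lt_integral_of_continuousOn_of_le_of_exists_lt ht0
      (continuous_integrand_right b).continuousOn (continuous_integrand_right a).continuousOn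
      (fun u hu => ?_) ⟨t, ⟨ht0.le, le_rfl⟩, ?_⟩
    · rw [integrand_eq, integrand_eq]
      have := hu.1.le
      gcongr
    · rw [integrand_eq, integrand_eq]
      gcongr
  exact ⟨y, hy.symm, fun z hz => hanti.injective (hz.symm.trans hy.symm)⟩

/-- `β(t)`: the unique real `y` with `1 = ∫₀ᵗ u e^{-y u} / (1 + e^{-y u}) du`, for `t > √2`. -/
def beta (t : ℝ) (ht : √2 < t) : ℝ := (existsUnique_beta ht).choose

theorem beta_spec {t : ℝ} (ht : √2 < t) :
    1 = ∫ u in (0 : ℝ)..t, integrand (beta t ht) u :=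
  (existsUnique_beta ht).choose_spec.1

/-- The admissible parts: the integers `k` with `1 ≤ k ≤ t √n`. -/
def parts (t : ℝ) (n : ℕ) : Finset ℕ := Finset.Icc 1 ⌊t * √(n : ℝ)⌋₊

theorem mem_parts {t : ℝ} {n k : ℕ} : k ∈ parts t n ↔ 1 ≤ k ∧ (k : ℝ) ≤ t * √(n : ℝ) := by
  unfold parts
  rw [Finset.mem_Icc, and_congr_right_iff]
  intro hk
  exact Nat.le_floor_iff' (by omega)

/-- The partitions (of any size) into distinct parts, all of them at most `t √n`. A partition into
distinct parts is the finite set of its parts. -/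
def Part (t : ℝ) (n : ℕ) : Type := {l : Finset ℕ // l ∈ (parts t n).powerset}

instance (t : ℝ) (n : ℕ) : Fintype (Part t n) :=
  inferInstanceAs (Fintype {l : Finset ℕ // l ∈ (parts t n).powerset})

instance (t : ℝ) (n : ℕ) : MeasurableSpace (Part t n) := ⊤

instance (t : ℝ) (n : ℕ) : DiscreteMeasurableSpace (Part t n) := ⟨fun _ => trivial⟩

/-- The size `|λ|` of a partition: the sum of its parts. -/
def Part.size {t : ℝ} {n : ℕ} (l : Part t n) : ℕ := ∑ k ∈ l.1, k

/-- The generating polynomial `∏_{k ≤ t √n} (1 + x^k)`. -/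
def genPoly (t : ℝ) (n : ℕ) (x : ℝ) : ℝ := ∏ k ∈ parts t n, (1 + x ^ k)

/-- The Boltzmann measure `P_{x,n}`, which gives mass `x^{|λ|} / ∏_{k ≤ t √n} (1 + x^k)` to the
partition `λ` (a probability measure for `x > 0`). -/
def boltzmann (t : ℝ) (n : ℕ) (x : ℝ) : Measure (Part t n) :=
  ∑ l : Part t n, ENNReal.ofReal (x ^ l.size / genPoly t n x) • Measure.dirac l

/-- `X_k`: the multiplicity of `k` in a partition. -/
def mult {t : ℝ} {n : ℕ} (k : ℕ) (l : Part t n) : ℕ := if k ∈ l.1 then 1 else 0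

/-- The random variable `N = ∑_{k ≤ t √n} k X_k`. -/
def N {t : ℝ} {n : ℕ} (l : Part t n) : ℝ := ∑ k ∈ parts t n, (k : ℝ) * (mult k l : ℝ)

/-- `σ_n`, the standard deviation of `N` under `P_{x,n}`. -/
def sigma (t : ℝ) (n : ℕ) (x : ℝ) : ℝ := √(Var[(N : Part t n → ℝ); boltzmann t n x])

theorem N_eq_size {t : ℝ} {n : ℕ} (l : Part t n) : N l = l.size := by
  have hl : l.1 ⊆ parts t n := Finset.mem_powerset.1 l.2
  simp only [N, mult, Part.size, Nat.cast_ite, Nat.cast_one, Nat.cast_zero, mul_ite, mul_one,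
    mul_zero, Nat.cast_sum]
  rw [← Finset.sum_filter, Finset.filter_mem_eq_inter, Finset.inter_eq_right.2 hl]

theorem sum_pow_size (t : ℝ) (n : ℕ) (x : ℝ) :
    ∑ l : Part t n, x ^ l.size = genPoly t n x := by
  have h : ∀ s ∈ (parts t n).powerset, ∏ k ∈ s, x ^ k = x ^ ∑ k ∈ s, k := fun s _ =>
    Finset.prod_pow_eq_pow_sum s (fun k => k) x
  unfold genPoly
  rw [Finset.prod_one_add, Finset.sum_congr rfl h]
  exact Finset.sum_coe_sort (parts t n).powerset fun s => x ^ ∑ k ∈ s, k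

theorem isProbabilityMeasure_boltzmann (t : ℝ) (n : ℕ) {x : ℝ} (hx : 0 < x) :
    IsProbabilityMeasure (boltzmann t n x) := by
  have hD : 0 < genPoly t n x := Finset.prod_pos fun k _ => by positivity
  constructor
  simp only [boltzmann, Measure.coe_finsetSum, Measure.coe_smul, Finset.sum_apply, Pi.smul_apply,
    measure_univ, smul_eq_mul, mul_one]
  rw [← ENNReal.ofReal_sum_of_nonneg fun l _ => by positivity, ← Finset.sum_div, sum_pow_size,
    div_self hD.ne', ENNReal.ofReal_one]

/-- The value `x = e^{-β/√n}` of the parameter, `β = β(t)`. -/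
def param (t : ℝ) (ht : √2 < t) (n : ℕ) : ℝ := Real.exp (-(beta t ht) / √(n : ℝ))

end DistinctParts

end

/-! Under the Boltzmann measure the multiplicities are independent Bernoulli variables, so the
characteristic function of $N$ is a product (`shiftedCF_eq_prod`). Dividing parts by $\sqrt n$ turns
$E N/n$ into a Riemann sum of mesh $1/\sqrt n$ for the integral defining $\beta$; hence $E
N-n=O(\sqrt n)$. The scaled parts stay in $[0,t]$, so the Bernoulli variances are bounded below by
some $c>0$ and, with $M=\lfloor t\sqrt n\rfloor$, $\sigma_n^2$ has order $M^3$. Both the largest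
part and the centring error are therefore $o(\sigma_n)$.

Comparing each centred factor with a Gaussian of the same variance gives pointwise convergence of
characteristic functions (`tendsto_shiftedCF`), and Lévy's continuity theorem gives the
distributional limit.

For the local limit, $P(N=n)$ is the mean of the characteristic function of $N-n$ over a period.
After $\theta=s/\sigma_n$ the integrand tends to $e^{-s^2/2}$, and `exists_norm_shiftedCF_le`
supplies a dominating function: a quadratic cosine bound serves when $M|\theta|\le\pi$, the
Dirichlet kernel otherwise. -/

noncomputable section

namespace DistinctParts

/-! ### Estimates for one Bernoulli factor -/

/-- The characteristic function of a Bernoulli variable with parameter `p`. -/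
def bernoulliCF (p u : ℝ) : ℂ := (1 - p) + p * Complex.exp (u * Complex.I)

/-- Telescoping: replace the factors one at a time; all the others have norm at most one. -/
theorem norm_prod_sub_prod_le {ι : Type*} (s : Finset ι) (a b : ι → ℂ)
    (ha : ∀ i ∈ s, ‖a i‖ ≤ 1) (hb : ∀ i ∈ s, ‖b i‖ ≤ 1) :
    ‖∏ i ∈ s, a i - ∏ i ∈ s, b i‖ ≤ ∑ i ∈ s, ‖a i - b i‖ := by
  classical
  induction s using Finset.induction_on with
  | empty => simp
  | insert i s hi ih =>
    rw [Finset.prod_insert hi, Finset.prod_insert hi, Finset.sum_insert hi]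
    have h1 : ‖∏ i ∈ s, a i‖ ≤ 1 := by
      rw [norm_prod]
      exact Finset.prod_le_one (fun _ _ => norm_nonneg _)
        fun j hj => ha j (Finset.mem_insert_of_mem hj)
    have h2 := ih (fun j hj => ha j (Finset.mem_insert_of_mem hj))
      (fun j hj => hb j (Finset.mem_insert_of_mem hj))
    have hbi := hb i (Finset.mem_insert_self _ _)
    calc ‖a i * ∏ i ∈ s, a i - b i * ∏ i ∈ s, b i‖
        = ‖(a i - b i) * ∏ i ∈ s, a i + b i * (∏ i ∈ s, a i - ∏ i ∈ s, b i)‖ := by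
          congr 1; ring
      _ ≤ ‖a i - b i‖ * ‖∏ i ∈ s, a i‖ + ‖b i‖ * ‖∏ i ∈ s, a i - ∏ i ∈ s, b i‖ := by
          refine (norm_add_le _ _).trans ?_
          rw [norm_mul, norm_mul]
      _ ≤ ‖a i - b i‖ * 1 + 1 * ∑ i ∈ s, ‖a i - b i‖ := by gcongr
      _ = _ := by ring

theorem norm_bernoulliCF_sq (p u : ℝ) :
    ‖bernoulliCF p u‖ ^ 2 = 1 - 2 * (p * (1 - p)) * (1 - Real.cos u) := by
  rw [← Complex.normSq_eq_norm_sq, Complex.normSq_apply, bernoulliCF]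
  have hre : (Complex.exp (u * Complex.I)).re = Real.cos u := Complex.exp_ofReal_mul_I_re u
  have him : (Complex.exp (u * Complex.I)).im = Real.sin u := Complex.exp_ofReal_mul_I_im u
  simp [hre, him]
  linear_combination p ^ 2 * Real.sin_sq_add_cos_sq u

theorem norm_bernoulliCF_le (p u : ℝ) :
    ‖bernoulliCF p u‖ ≤ Real.exp (-(p * (1 - p) * (1 - Real.cos u))) := by
  refine le_of_sq_le_sq ?_ (Real.exp_pos _).le
  rw [norm_bernoulliCF_sq, ← Real.exp_nat_mul]
  refine le_trans (le_of_eq ?_) (Real.add_one_le_exp _)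
  push_cast
  ring

theorem norm_exp_mul_I_sub_taylor_le {v : ℝ} (hv : |v| ≤ 1) :
    ‖Complex.exp (v * Complex.I) - (1 + v * Complex.I - v ^ 2 / 2)‖ ≤ |v| ^ 3 := by
  have hn : ‖(v : ℂ) * Complex.I‖ = |v| := by simp
  have h := Complex.exp_bound (x := v * Complex.I) (by rw [hn]; exact hv) (n := 3) (by norm_num)
  rw [hn] at h
  have he : (∑ m ∈ Finset.range 3, ((v : ℂ) * Complex.I) ^ m / (m.factorial : ℂ))
      = 1 + v * Complex.I - v ^ 2 / 2 := by
    simp [Finset.sum_range_succ, mul_pow, Nat.factorial]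
    ring
  rw [he] at h
  -- The remainder constant at order 3 is $4/(3!\cdot 3)=2/9$.
  refine h.trans (mul_le_of_le_one_right (by positivity) ?_)
  norm_num [Nat.factorial]

/-- The centred variable takes the values $-p$ and $1-p$, with mean $0$ and variance $p(1-p)$. Hence
the second-order Taylor polynomials average to $1+w$, the first-order expansion of the Gaussian
factor, and only remainders of size $|u|^3$ are left. -/
theorem norm_bernoulliCF_mul_exp_sub_le {p u : ℝ} (hp0 : 0 ≤ p) (hp1 : p ≤ 1) (hu : |u| ≤ 1) :
    ‖bernoulliCF p u * Complex.exp (((-(p * u) : ℝ) : ℂ) * Complex.I)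
      - Complex.exp ((-(p * (1 - p) * u ^ 2 / 2) : ℝ) : ℂ)‖ ≤ 3 * |u| ^ 3 := by
  set v₁ : ℝ := -(p * u) with hv₁
  set v₂ : ℝ := (1 - p) * u with hv₂
  set w : ℝ := -(p * (1 - p) * u ^ 2 / 2) with hw
  have hq0 : 0 ≤ 1 - p := by linarith
  have hu3 : |u| ^ 2 ≤ 1 := pow_le_one₀ (abs_nonneg u) hu
  have h₁ : |v₁| ≤ |u| := by
    rw [hv₁, abs_neg, abs_mul, abs_of_nonneg hp0]
    exact mul_le_of_le_one_left (abs_nonneg _) hp1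
  have h₂ : |v₂| ≤ |u| := by
    rw [hv₂, abs_mul, abs_of_nonneg hq0]
    exact mul_le_of_le_one_left (abs_nonneg _) (by linarith)
  have hpq : p * (1 - p) ≤ 1 := by nlinarith
  have hpq0 : 0 ≤ p * (1 - p) := mul_nonneg hp0 hq0
  have hw' : |w| ≤ |u| ^ 2 := by
    rw [hw, abs_neg, abs_of_nonneg (by positivity), sq_abs]
    nlinarith [sq_nonneg u]
  have e₁ := norm_exp_mul_I_sub_taylor_le (h₁.trans hu)
  have e₂ := norm_exp_mul_I_sub_taylor_le (h₂.trans hu)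
  have e₃ : ‖Complex.exp (w : ℂ) - 1 - w‖ ≤ |u| ^ 3 := by
    have h := Complex.norm_exp_sub_one_sub_id_le (x := (w : ℂ))
      (by rw [Complex.norm_real, Real.norm_eq_abs]; exact hw'.trans hu3)
    rw [Complex.norm_real, Real.norm_eq_abs] at h
    refine h.trans ?_
    calc |w| ^ 2 ≤ (|u| ^ 2) ^ 2 := by gcongr
      _ = |u| ^ 3 * |u| := by ring
      _ ≤ |u| ^ 3 := mul_le_of_le_one_right (by positivity) hu
  have e₁' := e₁.trans (pow_le_pow_left₀ (abs_nonneg _) h₁ 3)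
  have e₂' := e₂.trans (pow_le_pow_left₀ (abs_nonneg _) h₂ 3)
  have hexp : Complex.exp (u * Complex.I) * Complex.exp ((v₁ : ℂ) * Complex.I)
      = Complex.exp ((v₂ : ℂ) * Complex.I) := by
    rw [← Complex.exp_add]
    congr 1
    rw [hv₁, hv₂]
    push_cast
    ring
  have hid : bernoulliCF p u * Complex.exp ((v₁ : ℂ) * Complex.I) - Complex.exp (w : ℂ)
      = ((1 - p : ℝ) : ℂ) * (Complex.exp ((v₁ : ℂ) * Complex.I)
          - (1 + v₁ * Complex.I - v₁ ^ 2 / 2))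
        + (p : ℂ) * (Complex.exp ((v₂ : ℂ) * Complex.I) - (1 + v₂ * Complex.I - v₂ ^ 2 / 2))
        - (Complex.exp (w : ℂ) - 1 - w) := by
    rw [bernoulliCF, add_mul, mul_assoc, hexp, hv₁, hv₂, hw]
    push_cast
    ring
  rw [hid]
  refine (norm_sub_le _ _).trans ?_
  refine (add_le_add (norm_add_le _ _) le_rfl).trans ?_
  rw [norm_mul, norm_mul, Complex.norm_real, Complex.norm_real, Real.norm_of_nonneg hp0,
    Real.norm_of_nonneg hq0]
  have hu0 : 0 ≤ |u| ^ 3 := by positivity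
  have : (1 - p) * ‖Complex.exp ((v₁ : ℂ) * Complex.I) - (1 + v₁ * Complex.I - v₁ ^ 2 / 2)‖
      ≤ (1 - p) * |u| ^ 3 := by gcongr
  have : p * ‖Complex.exp ((v₂ : ℂ) * Complex.I) - (1 + v₂ * Complex.I - v₂ ^ 2 / 2)‖
      ≤ p * |u| ^ 3 := by gcongr
  nlinarith

/-! ### Lower bounds for cosine sums -/

/-- The Dirichlet kernel in the form without division. -/
theorem two_mul_sin_mul_sum_cos (θ : ℝ) (M : ℕ) :
    2 * Real.sin (θ / 2) * ∑ k ∈ Finset.Icc 1 M, Real.cos (k * θ)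
      = Real.sin ((M + 1 / 2) * θ) - Real.sin (θ / 2) := by
  induction M with
  | zero => simp; ring_nf
  | succ M ih =>
    rw [Finset.sum_Icc_succ_top (by omega), mul_add, ih]
    have h1 : ((M + 1 : ℕ) + 1 / 2 : ℝ) * θ = (M + 1 : ℕ) * θ + θ / 2 := by ring
    have h2 : (M + 1 / 2 : ℝ) * θ = (M + 1 : ℕ) * θ - θ / 2 := by push_cast; ring
    rw [h1, h2, Real.sin_add, Real.sin_sub]
    ring

/-- By the Dirichlet kernel, $2\sin(\theta/2)\sum\cos k\theta\le 1$, while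
$\sin(\theta/2)\ge\theta/\pi\ge 1/M$ for $\theta>0$. -/
theorem half_le_sum_one_sub_cos {θ : ℝ} (hθ : |θ| ≤ Real.pi) {M : ℕ} (hM : Real.pi ≤ M * |θ|) :
    (M : ℝ) / 2 ≤ ∑ k ∈ Finset.Icc 1 M, (1 - Real.cos (k * θ)) := by
  wlog h0 : 0 ≤ θ generalizing θ
  · have := this (θ := -θ) (by rwa [abs_neg]) (by rwa [abs_neg]) (by linarith)
    simpa using this
  rw [abs_of_nonneg h0] at hθ hM
  have hθ0 : 0 < θ := by
    rcases h0.eq_or_lt with h | h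
    · rw [← h, mul_zero] at hM
      linarith [Real.pi_pos]
    · exact h
  have hs : θ / Real.pi ≤ Real.sin (θ / 2) := by
    have := Real.mul_le_sin (x := θ / 2) (by positivity) (by linarith)
    refine le_trans (le_of_eq ?_) this
    ring
  have hMs : 1 ≤ M * Real.sin (θ / 2) := by
    refine le_trans ?_ (mul_le_mul_of_nonneg_left hs (Nat.cast_nonneg M))
    rw [← mul_div_assoc, le_div_iff₀ Real.pi_pos]
    linarith
  have hspos : 0 < Real.sin (θ / 2) := lt_of_lt_of_le (by positivity) hs
  have hD := two_mul_sin_mul_sum_cos θ M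
  have hle := Real.sin_le_one ((M + 1 / 2) * θ)
  rw [Finset.sum_sub_distrib]
  simp only [Finset.sum_const, Nat.card_Icc, add_tsub_cancel_right, nsmul_eq_mul, mul_one]
  set S := ∑ k ∈ Finset.Icc 1 M, Real.cos (k * θ)
  have : S ≤ M / 2 := by
    have h : Real.sin (θ / 2) * S ≤ Real.sin (θ / 2) * (M / 2) := by linarith
    exact le_of_mul_le_mul_left h hspos
  linarith

/-- Every $k\theta$ stays in $[-\pi,\pi]$, where $1-\cos y\ge 2y^2/\pi^2$. -/
theorem mul_sum_sq_le_sum_one_sub_cos {θ : ℝ} {M : ℕ} (hM : M * |θ| ≤ Real.pi) :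
    2 / Real.pi ^ 2 * θ ^ 2 * ∑ k ∈ Finset.Icc 1 M, (k : ℝ) ^ 2
      ≤ ∑ k ∈ Finset.Icc 1 M, (1 - Real.cos (k * θ)) := by
  rw [Finset.mul_sum]
  refine Finset.sum_le_sum fun k hk => ?_
  have hkM : (k : ℝ) ≤ M := by exact_mod_cast (Finset.mem_Icc.1 hk).2
  have habs : |(k : ℝ) * θ| ≤ Real.pi := by
    rw [abs_mul, Nat.abs_cast]
    exact (mul_le_mul_of_nonneg_right hkM (abs_nonneg θ)).trans hM
  have := Real.cos_le_one_sub_mul_cos_sq habs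
  nlinarith

theorem cube_div_three_le_sum_sq (M : ℕ) :
    (M : ℝ) ^ 3 / 3 ≤ ∑ k ∈ Finset.Icc 1 M, (k : ℝ) ^ 2 := by
  induction M with
  | zero => simp
  | succ M ih =>
    rw [Finset.sum_Icc_succ_top (by omega)]
    push_cast
    nlinarith [Nat.cast_nonneg (α := ℝ) M]

theorem sum_sq_le_cube (M : ℕ) : ∑ k ∈ Finset.Icc 1 M, (k : ℝ) ^ 2 ≤ (M : ℝ) ^ 3 := by
  refine (Finset.sum_le_card_nsmul _ _ ((M : ℝ) ^ 2) fun k hk => ?_).trans (le_of_eq ?_)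
  · have : (k : ℝ) ≤ M := by exact_mod_cast (Finset.mem_Icc.1 hk).2
    gcongr
  · simp
    ring

/-! ### Mean and variance of `N` -/

/-- Splitting on whether `a` is a part; this drives the inductions for both moments. -/
theorem sum_powerset_insert_prod_mul {s : Finset ℕ} {a : ℕ} (ha : a ∉ s) (w : ℕ → ℝ)
    (f : ℝ → ℝ) :
    ∑ A ∈ (insert a s).powerset, (∏ k ∈ A, w k) * f (∑ k ∈ A, (k : ℝ))
      = ∑ A ∈ s.powerset, (∏ k ∈ A, w k) *
          (f (∑ k ∈ A, (k : ℝ)) + w a * f (a + ∑ k ∈ A, (k : ℝ))) := by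
  rw [Finset.sum_powerset_insert ha, ← Finset.sum_add_distrib]
  refine Finset.sum_congr rfl fun A hA => ?_
  have haA : a ∉ A := fun h => ha (Finset.mem_powerset.1 hA h)
  rw [Finset.prod_insert haA, Finset.sum_insert haA]
  ring

theorem sum_powerset_centered (s : Finset ℕ) {w : ℕ → ℝ} (hw : ∀ k, 0 < w k) :
    ∑ A ∈ s.powerset, (∏ k ∈ A, w k) *
      (∑ k ∈ A, (k : ℝ) - ∑ k ∈ s, (k : ℝ) * (w k / (1 + w k))) = 0 := by
  induction s using Finset.induction_on with
  | empty => simp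
  | insert a s ha ih =>
    rw [sum_powerset_insert_prod_mul ha w
      fun y => y - ∑ k ∈ insert a s, (k : ℝ) * (w k / (1 + w k)), Finset.sum_insert ha]
    have h1 : 1 + w a ≠ 0 := by linarith [hw a]
    rw [← mul_zero (1 + w a), ← ih, Finset.mul_sum]
    refine Finset.sum_congr rfl fun A _ => ?_
    field_simp
    ring

theorem sum_powerset_centered_sq (s : Finset ℕ) {w : ℕ → ℝ} (hw : ∀ k, 0 < w k) :
    ∑ A ∈ s.powerset, (∏ k ∈ A, w k) *
      (∑ k ∈ A, (k : ℝ) - ∑ k ∈ s, (k : ℝ) * (w k / (1 + w k))) ^ 2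
      = (∏ k ∈ s, (1 + w k)) *
        ∑ k ∈ s, (k : ℝ) ^ 2 * (w k / (1 + w k) * (1 - w k / (1 + w k))) := by
  induction s using Finset.induction_on with
  | empty => simp
  | insert a s ha ih =>
    rw [sum_powerset_insert_prod_mul ha w
      fun y => (y - ∑ k ∈ insert a s, (k : ℝ) * (w k / (1 + w k))) ^ 2,
      Finset.sum_insert ha, Finset.sum_insert ha, Finset.prod_insert ha]
    have h1 : 1 + w a ≠ 0 := by linarith [hw a]
    set m := ∑ k ∈ s, (k : ℝ) * (w k / (1 + w k)) with hm
    -- The cross term cancels for each `A` because $w_a(1-p_a)=p_a$ with $p_a=w_a/(1+w_a)$.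
    have hstep : ∀ A ∈ s.powerset, (∏ k ∈ A, w k) *
        ((∑ k ∈ A, (k : ℝ) - (a * (w a / (1 + w a)) + m)) ^ 2
          + w a * (a + ∑ k ∈ A, (k : ℝ) - (a * (w a / (1 + w a)) + m)) ^ 2)
        = (1 + w a) * ((∏ k ∈ A, w k) * (∑ k ∈ A, (k : ℝ) - m) ^ 2)
          + (1 + w a) * (a ^ 2 * (w a / (1 + w a) * (1 - w a / (1 + w a)))) * ∏ k ∈ A, w k := by
      intro A _
      field_simp
      ring
    rw [Finset.sum_congr rfl hstep, Finset.sum_add_distrib, ← Finset.mul_sum, ← Finset.mul_sum, ih,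
      ← Finset.prod_one_add]
    ring

/-- The probability that `k` is a part. -/
def prob (x : ℝ) (k : ℕ) : ℝ := x ^ k / (1 + x ^ k)

/-- The expectation of `N`. -/
def mean (t : ℝ) (n : ℕ) (x : ℝ) : ℝ := ∑ k ∈ parts t n, (k : ℝ) * prob x k

theorem prob_nonneg {x : ℝ} (hx : 0 < x) (k : ℕ) : 0 ≤ prob x k := by
  unfold prob; positivity

theorem prob_le_one {x : ℝ} (hx : 0 < x) (k : ℕ) : prob x k ≤ 1 := by
  unfold prob
  rw [div_le_one (by positivity)]
  linarith

theorem genPoly_pos (t : ℝ) (n : ℕ) {x : ℝ} (hx : 0 < x) : 0 < genPoly t n x :=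
  Finset.prod_pos fun k _ => by positivity

theorem integral_boltzmann {E : Type*} [NormedAddCommGroup E] [NormedSpace ℝ E] [CompleteSpace E]
    (t : ℝ) (n : ℕ) {x : ℝ} (hx : 0 < x) (f : Part t n → E) :
    ∫ l, f l ∂boltzmann t n x = ∑ l : Part t n, (x ^ l.size / genPoly t n x) • f l := by
  have hD := genPoly_pos t n hx
  unfold boltzmann
  rw [integral_finsetSum_measure fun l _ =>
    (integrable_dirac (by simp [enorm_lt_top])).smul_measure ENNReal.ofReal_ne_top]
  refine Finset.sum_congr rfl fun l _ => ?_
  rw [integral_smul_measure, integral_dirac, ENNReal.toReal_ofReal (by positivity)]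

theorem sum_part {E : Type*} [AddCommMonoid E] (t : ℝ) (n : ℕ) (f : Finset ℕ → E) :
    ∑ l : Part t n, f l.1 = ∑ A ∈ (parts t n).powerset, f A :=
  Finset.sum_coe_sort (parts t n).powerset f

theorem integral_N (t : ℝ) (n : ℕ) {x : ℝ} (hx : 0 < x) :
    ∫ l, N l ∂boltzmann t n x = mean t n x := by
  have hD := genPoly_pos t n hx
  have h := sum_powerset_centered (parts t n) (w := fun k => x ^ k) fun k => by positivity
  rw [← sum_part t n fun A => (∏ k ∈ A, x ^ k) * (∑ k ∈ A, (k : ℝ)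
    - ∑ k ∈ parts t n, (k : ℝ) * (x ^ k / (1 + x ^ k)))] at h
  rw [integral_boltzmann t n hx]
  have hsum := sum_pow_size t n x
  have h' : ∑ l : Part t n, x ^ l.size * (N l - mean t n x) = 0 := by
    rw [← h]
    refine Finset.sum_congr rfl fun l _ => ?_
    rw [N_eq_size, Part.size, Finset.prod_pow_eq_pow_sum l.1 (fun k => k) x]
    push_cast
    rfl
  simp_rw [mul_sub, Finset.sum_sub_distrib, ← Finset.sum_mul, hsum] at h'
  simp_rw [smul_eq_mul, div_mul_eq_mul_div, ← Finset.sum_div]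
  rw [div_eq_iff hD.ne']
  linarith

theorem variance_N (t : ℝ) (n : ℕ) {x : ℝ} (hx : 0 < x) :
    Var[(N : Part t n → ℝ); boltzmann t n x]
      = ∑ k ∈ parts t n, (k : ℝ) ^ 2 * (prob x k * (1 - prob x k)) := by
  have hD := genPoly_pos t n hx
  have h := sum_powerset_centered_sq (parts t n) (w := fun k => x ^ k) fun k => by positivity
  rw [← sum_part t n fun A => (∏ k ∈ A, x ^ k) * (∑ k ∈ A, (k : ℝ)
    - ∑ k ∈ parts t n, (k : ℝ) * (x ^ k / (1 + x ^ k))) ^ 2] at h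
  rw [variance_eq_integral (Measurable.of_discrete.aemeasurable), integral_N t n hx,
    integral_boltzmann t n hx]
  have h' : ∑ l : Part t n, x ^ l.size * (N l - mean t n x) ^ 2 = genPoly t n x *
      ∑ k ∈ parts t n, (k : ℝ) ^ 2 * (prob x k * (1 - prob x k)) := by
    refine Eq.trans (Finset.sum_congr rfl fun l _ => ?_) h
    rw [N_eq_size, Part.size, Finset.prod_pow_eq_pow_sum l.1 (fun k => k) x]
    push_cast
    rfl
  simp_rw [smul_eq_mul, div_mul_eq_mul_div, ← Finset.sum_div]
  rw [h', mul_div_cancel_left₀ _ hD.ne']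

theorem sigma_sq (t : ℝ) (n : ℕ) {x : ℝ} (hx : 0 < x) :
    sigma t n x ^ 2 = ∑ k ∈ parts t n, (k : ℝ) ^ 2 * (prob x k * (1 - prob x k)) := by
  rw [sigma, Real.sq_sqrt (variance_nonneg _ _), variance_N t n hx]

/-! ### The characteristic function and Fourier inversion -/

/-- The characteristic function of `N - n`. -/
def shiftedCF (t : ℝ) (n : ℕ) (x θ : ℝ) : ℂ :=
  ∫ l, Complex.exp ((θ * (N l - n) : ℝ) * Complex.I) ∂boltzmann t n x

/-- Independence in algebraic form: expanding $\prod(1+x^ke^{ik\theta})$ gives one term for each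
partition. -/
theorem shiftedCF_eq_prod (t : ℝ) (n : ℕ) {x : ℝ} (hx : 0 < x) (θ : ℝ) :
    shiftedCF t n x θ = Complex.exp ((-(θ * n) : ℝ) * Complex.I) *
      ∏ k ∈ parts t n, bernoulliCF (prob x k) (k * θ) := by
  have hD := genPoly_pos t n hx
  have hfac : ∀ k ∈ parts t n, bernoulliCF (prob x k) (k * θ)
      = (1 + (x : ℂ) ^ k * Complex.exp ((k * θ : ℝ) * Complex.I)) / ((1 + x ^ k : ℝ) : ℂ) := by
    intro k _
    have h1 : (1 + x ^ k : ℝ) ≠ 0 := by positivity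
    have h2 : (1 + (x : ℂ) ^ k) ≠ 0 := by exact_mod_cast h1
    rw [bernoulliCF, prob]
    push_cast
    field_simp
    ring
  rw [Finset.prod_congr rfl hfac, Finset.prod_div_distrib, Finset.prod_one_add,
    ← sum_part t n, shiftedCF, integral_boltzmann t n hx, Finset.sum_div, Finset.mul_sum]
  refine Finset.sum_congr rfl fun l _ => ?_
  rw [Finset.prod_mul_distrib, Finset.prod_pow_eq_pow_sum l.1 (fun k => k) (x : ℂ),
    ← Complex.exp_sum, ← Finset.sum_mul, N_eq_size, Complex.real_smul, genPoly]
  rw [show ((θ * (l.size - n) : ℝ) : ℂ) * Complex.I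
    = (-(θ * n) : ℝ) * Complex.I + (∑ k ∈ l.1, ((k * θ : ℝ) : ℂ)) * Complex.I by
      rw [Part.size]; push_cast; rw [← Finset.sum_mul]; ring, Complex.exp_add, Part.size]
  push_cast
  ring

theorem norm_shiftedCF_le (t : ℝ) (n : ℕ) {x : ℝ} (hx : 0 < x) {c : ℝ}
    (hc : ∀ k ∈ parts t n, c ≤ prob x k * (1 - prob x k)) (θ : ℝ) :
    ‖shiftedCF t n x θ‖ ≤ Real.exp (-(c * ∑ k ∈ parts t n, (1 - Real.cos (k * θ)))) := by
  rw [shiftedCF_eq_prod t n hx, norm_mul, Complex.norm_exp_ofReal_mul_I, one_mul, norm_prod,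
    Finset.mul_sum, ← Finset.sum_neg_distrib, Real.exp_sum]
  refine Finset.prod_le_prod (fun _ _ => norm_nonneg _) fun k hk => ?_
  refine (norm_bernoulliCF_le _ _).trans (Real.exp_le_exp.2 ?_)
  have := Real.cos_le_one (k * θ)
  have := mul_le_mul_of_nonneg_right (hc k hk) (by linarith : 0 ≤ 1 - Real.cos (k * θ))
  linarith

theorem continuous_shiftedCF (t : ℝ) (n : ℕ) {x : ℝ} (hx : 0 < x) :
    Continuous (shiftedCF t n x) := by
  have : shiftedCF t n x = fun θ => Complex.exp ((-(θ * n) : ℝ) * Complex.I) *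
      ∏ k ∈ parts t n, bernoulliCF (prob x k) (k * θ) :=
    funext fun θ => shiftedCF_eq_prod t n hx θ
  rw [this]
  unfold bernoulliCF
  fun_prop

theorem integral_exp_int_mul_I (m : ℤ) :
    ∫ θ in (-Real.pi)..Real.pi, Complex.exp ((θ * m : ℝ) * Complex.I)
      = if m = 0 then ((2 * Real.pi : ℝ) : ℂ) else 0 := by
  split_ifs with h
  · subst h
    simp
    ring
  · have hc : (m : ℂ) * Complex.I ≠ 0 := mul_ne_zero (by exact_mod_cast h) Complex.I_ne_zero
    have h1 : ∀ θ : ℝ, ((θ * m : ℝ) : ℂ) * Complex.I = (m * Complex.I) * θ := by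
      intro θ; push_cast; ring
    simp_rw [h1]
    rw [integral_exp_mul_complex hc, div_eq_zero_iff]
    left
    rw [sub_eq_zero, Complex.exp_eq_exp_iff_exists_int]
    exact ⟨m, by push_cast; ring⟩

/-- Fourier inversion: $N-n$ is an integer, so orthogonality of the exponentials keeps only the
partitions of size $n$. -/
theorem integral_shiftedCF (t : ℝ) (n : ℕ) {x : ℝ} (hx : 0 < x) :
    ∫ θ in (-Real.pi)..Real.pi, shiftedCF t n x θ
      = ((2 * Real.pi * (boltzmann t n x).real {l | N l = (n : ℝ)} : ℝ) : ℂ) := by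
  have := isProbabilityMeasure_boltzmann t n hx
  have hreal : (boltzmann t n x).real {l | N l = (n : ℝ)}
      = ∑ l : Part t n, (x ^ l.size / genPoly t n x) * (if N l = (n : ℝ) then 1 else 0) := by
    rw [← integral_indicator_one (MeasurableSet.of_discrete), integral_boltzmann t n hx]
    refine Finset.sum_congr rfl fun l _ => ?_
    rw [smul_eq_mul, Set.indicator_apply]
    rfl
  rw [hreal]
  simp_rw [shiftedCF, integral_boltzmann t n hx]
  rw [intervalIntegral.integral_finsetSum fun l _ =>
    (Continuous.intervalIntegrable (by fun_prop) _ _)]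
  rw [Finset.mul_sum, Complex.ofReal_sum]
  refine Finset.sum_congr rfl fun l _ => ?_
  rw [intervalIntegral.integral_smul]
  have h1 : ∀ θ : ℝ, θ * (N l - n) = θ * (((l.size : ℤ) - n : ℤ) : ℝ) := by
    intro θ; rw [N_eq_size]; push_cast; ring
  simp_rw [h1]
  rw [integral_exp_int_mul_I, N_eq_size, Complex.real_smul]
  have h2 : ((l.size : ℤ) - n = 0) ↔ ((l.size : ℝ) = n) := by
    rw [sub_eq_zero]; norm_cast
  simp only [h2]
  split_ifs <;> push_cast <;> ring

/-! ### Riemann sums and the centring of `N` -/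

/-- Each full cell costs $Kh^2$, there are at most $t/h$ of them, and the incomplete last cell costs
$Ch$. A rate is needed: convergence alone would give only $E N-n=o(n)$, too weak against $\sigma_n$
of order $n^{3/4}$. -/
theorem abs_riemannSum_sub_integral_le {g : ℝ → ℝ} (hg : Continuous g) {t K C h : ℝ} {M : ℕ}
    (hK : ∀ u ∈ Set.Icc 0 t, ∀ v ∈ Set.Icc 0 t, |g u - g v| ≤ K * |u - v|)
    (hC : ∀ u ∈ Set.Icc 0 t, |g u| ≤ C) (hK0 : 0 ≤ K) (hC0 : 0 ≤ C) (hh : 0 < h)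
    (hM : M * h ≤ t) (hM' : t ≤ (M + 1) * h) :
    |∑ k ∈ Finset.Icc 1 M, h * g (k * h) - ∫ u in (0 : ℝ)..t, g u| ≤ (K * t + C) * h := by
  have hint (a b : ℝ) : IntervalIntegrable g volume a b := hg.intervalIntegrable a b
  have hM0 : 0 ≤ M * h := by positivity
  have hsum : ∑ k ∈ Finset.Icc 1 M, h * g (k * h)
      = ∑ k ∈ Finset.range M, ∫ _ in (k * h)..((k + 1 : ℕ) * h), g ((k + 1 : ℕ) * h) := by
    rw [← Finset.Ico_add_one_right_eq_Icc, Finset.sum_Ico_eq_sum_range]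
    refine Finset.sum_congr rfl fun k _ => ?_
    rw [intervalIntegral.integral_const, smul_eq_mul, add_comm 1 k]
    push_cast
    ring
  have hpieces : ∑ k ∈ Finset.range M, ∫ u in (k * h)..((k + 1 : ℕ) * h), g u
      = ∫ u in (0 : ℝ)..(M * h), g u := by
    have := intervalIntegral.sum_integral_adjacent_intervals (μ := volume) (f := g)
      (a := fun k : ℕ => (k : ℝ) * h) (n := M) fun k _ => hint _ _
    simpa using this
  have hsplit : ∫ u in (0 : ℝ)..t, g u
      = (∫ u in (0 : ℝ)..(M * h), g u) + ∫ u in (M * h)..t, g u :=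
    (intervalIntegral.integral_add_adjacent_intervals (hint _ _) (hint _ _)).symm
  have htail : |∫ u in (M * h)..t, g u| ≤ C * h := by
    have := intervalIntegral.norm_integral_le_of_norm_le_const (a := M * h) (b := t) (f := g)
      (C := C) fun u hu => by
        rw [Set.uIoc_of_le hM] at hu
        exact hC u ⟨hM0.trans hu.1.le, hu.2⟩
    refine this.trans ?_
    rw [abs_of_nonneg (by linarith)]
    exact mul_le_mul_of_nonneg_left (by linarith) hC0
  have hdiff : |∑ k ∈ Finset.range M, ((∫ _ in (k * h)..((k + 1 : ℕ) * h), g ((k + 1 : ℕ) * h))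
      - ∫ u in (k * h)..((k + 1 : ℕ) * h), g u)| ≤ K * t * h := by
    have hterm : ∀ k ∈ Finset.range M,
        |(∫ _ in (k * h)..((k + 1 : ℕ) * h), g ((k + 1 : ℕ) * h))
          - ∫ u in (k * h)..((k + 1 : ℕ) * h), g u| ≤ K * h * h := by
      intro k hk
      have hk1 : ((k + 1 : ℕ) : ℝ) ≤ M := by exact_mod_cast Finset.mem_range.1 hk
      have hkt : ((k + 1 : ℕ) : ℝ) * h ≤ t := (mul_le_mul_of_nonneg_right hk1 hh.le).trans hM
      have hk0 : 0 ≤ (k : ℝ) * h := by positivity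
      have hlen : ((k + 1 : ℕ) : ℝ) * h - k * h = h := by push_cast; ring
      rw [← intervalIntegral.integral_sub (by simp) (hint _ _)]
      have := intervalIntegral.norm_integral_le_of_norm_le_const (a := k * h)
        (b := (k + 1 : ℕ) * h) (f := fun u => g ((k + 1 : ℕ) * h) - g u) (C := K * h)
        fun u hu => by
          rw [Set.uIoc_of_le (by linarith)] at hu
          refine (hK _ ⟨by positivity, hkt⟩ u ⟨hk0.trans hu.1.le, hu.2.trans hkt⟩).trans ?_
          refine mul_le_mul_of_nonneg_left ?_ hK0
          rw [abs_of_nonneg (by linarith [hu.2])]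
          linarith [hu.1]
      rwa [hlen, abs_of_pos hh] at this
    refine (Finset.abs_sum_le_sum_abs _ _).trans ((Finset.sum_le_sum hterm).trans ?_)
    rw [Finset.sum_const, Finset.card_range, nsmul_eq_mul]
    nlinarith [mul_le_mul_of_nonneg_left hM (mul_nonneg hK0 hh.le)]
  rw [Finset.sum_sub_distrib, ← hsum, hpieces] at hdiff
  rw [hsplit]
  rw [abs_le] at *
  constructor <;> nlinarith

theorem exists_lipschitz_integrand (y t : ℝ) :
    ∃ K : ℝ, 0 ≤ K ∧ ∀ u ∈ Set.Icc 0 t, ∀ v ∈ Set.Icc 0 t,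
      |integrand y u - integrand y v| ≤ K * |u - v| := by
  have hC : ContDiff ℝ 1 (integrand y) := by
    unfold integrand
    refine ContDiff.div (by fun_prop) (by fun_prop) fun u => ?_
    positivity
  obtain ⟨K, hK⟩ := (hC.locallyLipschitz.locallyLipschitzOn
    (s := Set.Icc 0 t)).exists_lipschitzOnWith_of_compact isCompact_Icc
  refine ⟨K, K.2, fun u hu v hv => ?_⟩
  simpa [Real.dist_eq] using hK.dist_le_mul u hu v hv

theorem abs_integrand_le {y t u : ℝ} (hu : u ∈ Set.Icc 0 t) : |integrand y u| ≤ t := by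
  rw [integrand_eq, abs_of_nonneg (div_nonneg hu.1 (by positivity))]
  refine (div_le_self hu.1 ?_).trans hu.2
  linarith [Real.exp_pos (y * u)]

variable {t : ℝ}

theorem pos_of_sqrt_two_lt (ht : √2 < t) : 0 < t := (Real.sqrt_nonneg 2).trans_lt ht

theorem param_pos (ht : √2 < t) (n : ℕ) : 0 < param t ht n := Real.exp_pos _

theorem param_pow (ht : √2 < t) (n k : ℕ) :
    param t ht n ^ k = Real.exp (-(beta t ht * (k * (1 / √(n : ℝ))))) := by
  rw [param, ← Real.exp_nat_mul]
  congr 1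
  ring

/-- `|E N - n| = O(√n)`. -/
theorem exists_abs_mean_sub_le (ht : √2 < t) :
    ∃ C : ℝ, ∀ n : ℕ, 1 ≤ n → |mean t n (param t ht n) - n| ≤ C * √(n : ℝ) := by
  obtain ⟨K, hK0, hK⟩ := exists_lipschitz_integrand (beta t ht) t
  have ht0 := pos_of_sqrt_two_lt ht
  refine ⟨K * t + t, fun n hn => ?_⟩
  have hn0 : (0 : ℝ) < n := by exact_mod_cast hn
  have hs : 0 < √(n : ℝ) := Real.sqrt_pos.2 hn0
  have hss : √(n : ℝ) * √(n : ℝ) = n := Real.mul_self_sqrt hn0.le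
  have hfl := Nat.floor_le (a := t * √(n : ℝ)) (by positivity)
  have hfl' := (Nat.lt_floor_add_one (t * √(n : ℝ))).le
  have h := abs_riemannSum_sub_integral_le (continuous_integrand_right (beta t ht)) hK
    (fun u hu => abs_integrand_le hu) hK0 ht0.le (h := 1 / √(n : ℝ)) (by positivity)
    (M := ⌊t * √(n : ℝ)⌋₊)
    (by rw [mul_one_div, div_le_iff₀ hs]; exact hfl)
    (by rw [mul_one_div, le_div_iff₀ hs]; exact hfl')
  rw [← beta_spec ht] at h
  -- The weights match because $n\cdot n^{-1/2}\cdot(k/\sqrt n)=k$.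
  have hmean : mean t n (param t ht n) = n * ∑ k ∈ Finset.Icc 1 ⌊t * √(n : ℝ)⌋₊,
      1 / √(n : ℝ) * integrand (beta t ht) (k * (1 / √(n : ℝ))) := by
    rw [mean, parts, Finset.mul_sum]
    refine Finset.sum_congr rfl fun k _ => ?_
    rw [prob, param_pow, integrand]
    nth_rewrite 3 [← hss]
    field_simp
  rw [hmean, show ∀ S : ℝ, n * S - n = n * (S - 1) by intro S; ring, abs_mul, abs_of_pos hn0]
  refine (mul_le_mul_of_nonneg_left h hn0.le).trans (le_of_eq ?_)
  nth_rewrite 1 [← hss]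
  field_simp

/-! ### The order of magnitude of `sigma` -/

/-- Since $0\le k/\sqrt n\le t$, the weight $x^k$ lies between $e^{-B}$ and $e^{B}$, uniformly in
$n$. -/
theorem exists_le_prob_mul (ht : √2 < t) :
    ∃ c : ℝ, 0 < c ∧ ∀ n : ℕ, ∀ k ∈ parts t n,
      c ≤ prob (param t ht n) k * (1 - prob (param t ht n) k) := by
  set B := |beta t ht| * t with hB
  have ht0 := pos_of_sqrt_two_lt ht
  refine ⟨Real.exp (-B) / (1 + Real.exp B) ^ 2, by positivity, fun n k hk => ?_⟩
  obtain ⟨hk1, hkt⟩ := mem_parts.1 hk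
  have hk0 : (1 : ℝ) ≤ k := by exact_mod_cast hk1
  -- For $n=0$ no part is admissible, so `hk0` and `hkt` conflict.
  have hs : 0 < √(n : ℝ) := by
    by_contra h
    nlinarith [Real.sqrt_nonneg (n : ℝ)]
  have hfrac : k * (1 / √(n : ℝ)) ≤ t := by rwa [mul_one_div, div_le_iff₀ hs]
  have habs : |-(beta t ht * (k * (1 / √(n : ℝ))))| ≤ B := by
    rw [abs_neg, abs_mul, abs_of_nonneg (by positivity : 0 ≤ k * (1 / √(n : ℝ)))]
    exact mul_le_mul_of_nonneg_left hfrac (abs_nonneg _)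
  obtain ⟨h1, h2⟩ := abs_le.1 habs
  rw [prob, param_pow]
  set w := Real.exp (-(beta t ht * (k * (1 / √(n : ℝ)))))
  have hw0 : 0 < w := Real.exp_pos _
  have hw1 : Real.exp (-B) ≤ w := Real.exp_le_exp.2 h1
  have hw2 : w ≤ Real.exp B := Real.exp_le_exp.2 h2
  have : w / (1 + w) * (1 - w / (1 + w)) = w / (1 + w) ^ 2 := by field_simp; ring
  rw [this]
  gcongr

theorem mul_sum_sq_le_sigma_sq (n : ℕ) {x : ℝ} (hx : 0 < x) {c : ℝ}
    (hc : ∀ k ∈ parts t n, c ≤ prob x k * (1 - prob x k)) :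
    c * ∑ k ∈ parts t n, (k : ℝ) ^ 2 ≤ sigma t n x ^ 2 := by
  rw [sigma_sq t n hx, Finset.mul_sum]
  refine Finset.sum_le_sum fun k hk => ?_
  nlinarith [mul_le_mul_of_nonneg_left (hc k hk) (sq_nonneg (k : ℝ))]

theorem sigma_sq_le_sum_sq (n : ℕ) {x : ℝ} (hx : 0 < x) :
    sigma t n x ^ 2 ≤ ∑ k ∈ parts t n, (k : ℝ) ^ 2 := by
  rw [sigma_sq t n hx]
  refine Finset.sum_le_sum fun k hk => mul_le_of_le_one_right (sq_nonneg _) ?_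
  nlinarith [prob_nonneg hx k, prob_le_one hx k]

theorem tendsto_floor_atTop (ht : √2 < t) :
    Tendsto (fun n : ℕ => ((⌊t * √(n : ℝ)⌋₊ : ℕ) : ℝ)) atTop atTop := by
  refine tendsto_natCast_atTop_atTop.comp (tendsto_nat_floor_atTop.comp ?_)
  exact (Real.tendsto_sqrt_atTop.comp tendsto_natCast_atTop_atTop).const_mul_atTop
    (pos_of_sqrt_two_lt ht)

theorem sigma_nonneg (n : ℕ) (x : ℝ) : 0 ≤ sigma t n x := Real.sqrt_nonneg _

/-- Negligibility of the largest part: $\sigma_n^2\ge cM^3/3$ gives $(M/\sigma_n)^2\le 3/(cM)$. -/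
theorem tendsto_floor_div_sigma (ht : √2 < t) :
    Tendsto (fun n : ℕ => ((⌊t * √(n : ℝ)⌋₊ : ℕ) : ℝ) / sigma t n (param t ht n))
      atTop (𝓝 0) := by
  obtain ⟨c, hc0, hc⟩ := exists_le_prob_mul ht
  have hlim : Tendsto (fun n : ℕ => √(3 / c / ((⌊t * √(n : ℝ)⌋₊ : ℕ) : ℝ))) atTop (𝓝 0) := by
    have := (Real.continuous_sqrt.tendsto 0).comp ((tendsto_floor_atTop ht).const_div_atTop (3 / c))
    rwa [Real.sqrt_zero] at this
  refine squeeze_zero' (.of_forall fun n => div_nonneg (Nat.cast_nonneg _) (sigma_nonneg _ _)) ?_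
    hlim
  filter_upwards [(tendsto_floor_atTop ht).eventually_ge_atTop 1] with n hn
  have h1 := mul_sum_sq_le_sigma_sq n (param_pos ht n) (hc n)
  have h2 : ((⌊t * √(n : ℝ)⌋₊ : ℕ) : ℝ) ^ 3 / 3 ≤ ∑ k ∈ parts t n, (k : ℝ) ^ 2 :=
    cube_div_three_le_sum_sq _
  set M : ℝ := ((⌊t * √(n : ℝ)⌋₊ : ℕ) : ℝ)
  have hM0 : 0 < M := by linarith
  have h3 : c * (M ^ 3 / 3) ≤ sigma t n (param t ht n) ^ 2 :=
    (mul_le_mul_of_nonneg_left h2 hc0.le).trans h1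
  have h4 : 0 < c * (M ^ 3 / 3) := by positivity
  refine Real.le_sqrt_of_sq_le ?_
  rw [div_pow, div_le_iff₀ (by linarith)]
  calc M ^ 2 = 3 / c / M * (c * (M ^ 3 / 3)) := by field_simp
    _ ≤ _ := mul_le_mul_of_nonneg_left h3 (by positivity)

theorem eventually_sigma_pos (ht : √2 < t) : ∀ᶠ n : ℕ in atTop, 0 < sigma t n (param t ht n) := by
  obtain ⟨c, hc0, hc⟩ := exists_le_prob_mul ht
  filter_upwards [(tendsto_floor_atTop ht).eventually_ge_atTop 1] with n hn
  have h1 := mul_sum_sq_le_sigma_sq n (param_pos ht n) (hc n)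
  have h2 : ((⌊t * √(n : ℝ)⌋₊ : ℕ) : ℝ) ^ 3 / 3 ≤ ∑ k ∈ parts t n, (k : ℝ) ^ 2 :=
    cube_div_three_le_sum_sq _
  refine (sigma_nonneg n _).lt_of_ne fun h => ?_
  rw [← h] at h1
  have h4 : 0 < c * (((⌊t * √(n : ℝ)⌋₊ : ℕ) : ℝ) ^ 3 / 3) := by positivity
  nlinarith

theorem tendsto_sigma_atTop (ht : √2 < t) :
    Tendsto (fun n : ℕ => sigma t n (param t ht n)) atTop atTop := by
  refine tendsto_atTop_mono' _ ?_ (tendsto_floor_atTop ht)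
  filter_upwards [(tendsto_floor_div_sigma ht).eventually_le_const (zero_lt_one),
    eventually_sigma_pos ht] with n hn hs
  rwa [div_le_one hs] at hn

theorem tendsto_mean_sub_div_sigma (ht : √2 < t) :
    Tendsto (fun n : ℕ => (mean t n (param t ht n) - n) / sigma t n (param t ht n))
      atTop (𝓝 0) := by
  obtain ⟨C, hC⟩ := exists_abs_mean_sub_le ht
  have ht0 := pos_of_sqrt_two_lt ht
  have hlim := (tendsto_floor_div_sigma ht).const_mul (|C| * (2 / t))
  rw [mul_zero] at hlim
  refine squeeze_zero_norm' ?_ hlim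
  filter_upwards [eventually_ge_atTop 1, eventually_sigma_pos ht,
    (tendsto_floor_atTop ht).eventually_ge_atTop 1] with n hn hs hM
  rw [Real.norm_eq_abs, abs_div, abs_of_pos hs, ← mul_div_assoc]
  gcongr
  refine (hC n hn).trans ?_
  have hfl' := (Nat.lt_floor_add_one (t * √(n : ℝ))).le
  -- For $M\ge1$, $t\sqrt n\le M+1\le 2M$.
  have h1 : √(n : ℝ) ≤ 2 / t * ((⌊t * √(n : ℝ)⌋₊ : ℕ) : ℝ) := by
    rw [div_mul_eq_mul_div, le_div_iff₀ ht0]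
    linarith
  rw [mul_assoc]
  exact mul_le_mul (le_abs_self C) h1 (Real.sqrt_nonneg _) (abs_nonneg C)

/-! ### Convergence and domination of characteristic functions -/

/-- The characteristic function of `(N - n) / σ` converges pointwise to the Gaussian one. -/
theorem tendsto_shiftedCF (ht : √2 < t) (s : ℝ) :
    Tendsto (fun n : ℕ => shiftedCF t n (param t ht n) (s / sigma t n (param t ht n)))
      atTop (𝓝 (Complex.exp ((-(s ^ 2 / 2) : ℝ) : ℂ))) := by
  obtain ⟨c, hc0, hc⟩ := exists_le_prob_mul ht
  have hphase : Tendsto (fun n : ℕ => Complex.exp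
      ((s * ((mean t n (param t ht n) - n) / sigma t n (param t ht n)) : ℝ) * Complex.I))
      atTop (𝓝 1) := by
    have h := (tendsto_mean_sub_div_sigma ht).const_mul s
    rw [mul_zero] at h
    have hcont : Continuous fun y : ℝ => Complex.exp ((y : ℂ) * Complex.I) := by fun_prop
    have h1 := (hcont.tendsto 0).comp h
    rwa [Complex.ofReal_zero, zero_mul, Complex.exp_zero] at h1
  -- `a` holds the centred Bernoulli factors and `b` the Gaussian factors of equal variance, whose
  -- product is exactly $e^{-s^2/2}$ when $\sigma_n>0$.
  set a : ℕ → ℕ → ℂ := fun n k =>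
    bernoulliCF (prob (param t ht n) k) (k * (s / sigma t n (param t ht n))) *
      Complex.exp (((-(prob (param t ht n) k * (k * (s / sigma t n (param t ht n)))) : ℝ) : ℂ)
        * Complex.I) with ha
  set b : ℕ → ℕ → ℂ := fun n k => Complex.exp ((-(prob (param t ht n) k *
    (1 - prob (param t ht n) k) * (k * (s / sigma t n (param t ht n))) ^ 2 / 2) : ℝ) : ℂ) with hb
  have hprod : Tendsto (fun n => ∏ k ∈ parts t n, a n k) atTop
      (𝓝 (Complex.exp ((-(s ^ 2 / 2) : ℝ) : ℂ))) := by
    rw [tendsto_iff_norm_sub_tendsto_zero]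
    have hlim := (tendsto_floor_div_sigma ht).const_mul (3 * |s| ^ 3 / c)
    rw [mul_zero] at hlim
    have hsmall := (tendsto_floor_div_sigma ht).const_mul |s|
    rw [mul_zero] at hsmall
    refine squeeze_zero' (.of_forall fun n => norm_nonneg _) ?_ hlim
    -- $|s|M/\sigma_n\le1$ puts every argument $ks/\sigma_n$ in the range of the Taylor estimate.
    filter_upwards [eventually_sigma_pos ht, hsmall.eventually_le_const zero_lt_one] with n hs h1
    have hx := param_pos ht n
    have hprodb : ∏ k ∈ parts t n, b n k = Complex.exp ((-(s ^ 2 / 2) : ℝ) : ℂ) := by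
      rw [hb, ← Complex.exp_sum, ← Complex.ofReal_sum]
      congr 2
      have : ∑ k ∈ parts t n, -(prob (param t ht n) k * (1 - prob (param t ht n) k) *
          (k * (s / sigma t n (param t ht n))) ^ 2 / 2)
          = -((s / sigma t n (param t ht n)) ^ 2 / 2) *
            ∑ k ∈ parts t n, (k : ℝ) ^ 2 * (prob (param t ht n) k * (1 - prob (param t ht n) k)) := by
        rw [Finset.mul_sum]
        exact Finset.sum_congr rfl fun k _ => by ring
      rw [this, ← sigma_sq t n hx]
      field_simp
    rw [← hprodb]
    set σ := sigma t n (param t ht n)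
    set M : ℝ := ((⌊t * √(n : ℝ)⌋₊ : ℕ) : ℝ) with hM
    have hpq : ∀ k, 0 ≤ prob (param t ht n) k * (1 - prob (param t ht n) k) := fun k =>
      mul_nonneg (prob_nonneg hx k) (by linarith [prob_le_one hx k])
    have hkM : ∀ k ∈ parts t n, (k : ℝ) ≤ M := fun k hk => by
      rw [hM]; exact_mod_cast (Finset.mem_Icc.1 hk).2
    have habs : ∀ k : ℕ, |k * (s / σ)| = k * |s| / σ := fun k => by
      rw [abs_mul, abs_div, Nat.abs_cast, abs_of_pos hs, mul_div_assoc]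
    have hterm : ∀ k ∈ parts t n, ‖a n k - b n k‖ ≤ 3 * |s| ^ 3 * (M / σ ^ 3) * (k : ℝ) ^ 2 := by
      intro k hk
      have hle : |k * (s / σ)| ≤ 1 := by
        rw [habs]
        refine le_trans ?_ h1
        rw [mul_div_assoc', mul_comm (k : ℝ)]
        gcongr
        exact hkM k hk
      refine (norm_bernoulliCF_mul_exp_sub_le (prob_nonneg hx k) (prob_le_one hx k) hle).trans ?_
      rw [habs, div_pow, mul_pow]
      calc 3 * ((k : ℝ) ^ 3 * |s| ^ 3 / σ ^ 3)
          = 3 * |s| ^ 3 * (k / σ ^ 3) * (k : ℝ) ^ 2 := by ring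
        _ ≤ _ := by
          gcongr
          exact hkM k hk
    refine (norm_prod_sub_prod_le _ _ _ (fun k hk => ?_) (fun k hk => ?_)).trans ?_
    · rw [ha]
      simp only
      rw [norm_mul, Complex.norm_exp_ofReal_mul_I, mul_one]
      refine (norm_bernoulliCF_le _ _).trans (Real.exp_le_one_iff.2 ?_)
      have := Real.cos_le_one (k * (s / σ))
      have := mul_nonneg (hpq k) (by linarith : 0 ≤ 1 - Real.cos (k * (s / σ)))
      linarith
    · rw [hb]
      simp only
      rw [← Complex.ofReal_exp, Complex.norm_real, Real.norm_of_nonneg (Real.exp_pos _).le]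
      refine Real.exp_le_one_iff.2 ?_
      have := mul_nonneg (hpq k) (sq_nonneg (k * (s / σ)))
      linarith
    -- Lyapunov's bound: one factor $k\le M$ is pulled out of $k^3$, and $\sum k^2\le\sigma_n^2/c$.
    · refine (Finset.sum_le_sum hterm).trans ?_
      rw [← Finset.mul_sum]
      have h2 := mul_sum_sq_le_sigma_sq n hx (hc n)
      have h3 : ∑ k ∈ parts t n, (k : ℝ) ^ 2 ≤ σ ^ 2 / c := by
        rw [le_div_iff₀ hc0]; linarith
      refine (mul_le_mul_of_nonneg_left h3 (by positivity)).trans (le_of_eq ?_)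
      field_simp
  have hmul := hphase.mul hprod
  rw [one_mul] at hmul
  refine hmul.congr fun n => ?_
  rw [shiftedCF_eq_prod t n (param_pos ht n), ha]
  simp only
  rw [Finset.prod_mul_distrib, ← Complex.exp_sum, mul_left_comm, mul_comm (Complex.exp _) (∏ k ∈ _, _),
    ← Complex.exp_add]
  congr 2
  rw [← Finset.sum_mul, ← add_mul, ← Complex.ofReal_sum, ← Complex.ofReal_add, mean]
  congr 2
  have : ∑ k ∈ parts t n, -(prob (param t ht n) k * (k * (s / sigma t n (param t ht n))))
      = -(s / sigma t n (param t ht n)) * ∑ k ∈ parts t n, (k : ℝ) * prob (param t ht n) k := by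
    rw [Finset.mul_sum]
    exact Finset.sum_congr rfl fun k _ => by ring
  rw [this]
  ring

/-- An integrable bound on the characteristic function of `(N - n) / σ`, uniform in `n`. -/
theorem exists_norm_shiftedCF_le (ht : √2 < t) :
    ∃ C : ℝ, ∀ n : ℕ, 0 < sigma t n (param t ht n) → ∀ s : ℝ,
      |s| ≤ Real.pi * sigma t n (param t ht n) →
      ‖shiftedCF t n (param t ht n) (s / sigma t n (param t ht n))‖ ≤ C * (1 + s ^ 2)⁻¹ := by
  obtain ⟨c, hc0, hc⟩ := exists_le_prob_mul ht
  have hπ := Real.pi_pos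
  -- Trades exponential decay for an integrable bound: $1+z\le(1+A)e^y$.
  have key : ∀ {A y z : ℝ}, 0 ≤ y → z ≤ A * Real.exp y → 0 ≤ z →
      Real.exp (-y) ≤ (1 + A) * (1 + z)⁻¹ := by
    intro A y z hy hz h
    rw [← div_eq_mul_inv, le_div_iff₀ (by positivity), Real.exp_neg,
      inv_mul_le_iff₀ (Real.exp_pos y)]
    nlinarith [Real.one_le_exp hy]
  -- One summand for each range of $M|\theta|$. The first comes from $s^2\le\pi^2M^3$ and $y^3/3!\le
  -- e^y$ at $y=cM/2$; the second from $y\le e^y$ at $y=2cs^2/\pi^2$.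
  refine ⟨(1 + 48 * Real.pi ^ 2 / c ^ 3) + (1 + Real.pi ^ 2 / (2 * c)), fun n hσ s hs => ?_⟩
  have hx := param_pos ht n
  have hup := sigma_sq_le_sum_sq (t := t) n hx
  refine (norm_shiftedCF_le t n hx (hc n) _).trans ?_
  set σ := sigma t n (param t ht n)
  set θ := s / σ with hθdef
  have hsθ : s = θ * σ := by rw [hθdef]; field_simp
  have hθ : |θ| ≤ Real.pi := by
    rw [hθdef, abs_div, abs_of_pos hσ, div_le_iff₀ hσ]; exact hs
  have hinv : 0 ≤ (1 + s ^ 2)⁻¹ := by positivity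
  rw [add_mul]
  rcases le_total Real.pi ((⌊t * √(n : ℝ)⌋₊ : ℕ) * |θ|) with h | h
  · have hD := half_le_sum_one_sub_cos hθ h
    have hcube := sum_sq_le_cube ⌊t * √(n : ℝ)⌋₊
    change (_ : ℝ) ≤ ∑ k ∈ parts t n, _ at hD
    change ∑ k ∈ parts t n, _ ≤ _ at hcube
    set M : ℝ := ((⌊t * √(n : ℝ)⌋₊ : ℕ) : ℝ)
    have hM0 : 0 ≤ M := Nat.cast_nonneg _
    refine le_trans ?_ (le_add_of_nonneg_right (by positivity))
    refine le_trans (Real.exp_le_exp.2 (?_ : _ ≤ -(c * (M / 2)))) (key (by positivity) ?_ (sq_nonneg s))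
    · have := mul_le_mul_of_nonneg_left hD hc0.le
      linarith
    · have h1 : s ^ 2 ≤ Real.pi ^ 2 * M ^ 3 := by
        calc s ^ 2 = |s| ^ 2 := (sq_abs s).symm
          _ ≤ (Real.pi * σ) ^ 2 := by gcongr
          _ = Real.pi ^ 2 * σ ^ 2 := by ring
          _ ≤ _ := by gcongr; exact hup.trans hcube
      have h2 := Real.pow_div_factorial_le_exp (c * (M / 2)) (by positivity) 3
      have h3 : Real.pi ^ 2 * M ^ 3
          = 48 * Real.pi ^ 2 / c ^ 3 * ((c * (M / 2)) ^ 3 / (Nat.factorial 3 : ℝ)) := by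
        norm_num [Nat.factorial]
        field_simp
        ring
      rw [h3] at h1
      exact h1.trans (mul_le_mul_of_nonneg_left h2 (by positivity))
  · have hD := mul_sum_sq_le_sum_one_sub_cos h
    change _ * ∑ k ∈ parts t n, _ ≤ ∑ k ∈ parts t n, _ at hD
    refine le_trans ?_ (le_add_of_nonneg_left (by positivity))
    have h1 : 2 / Real.pi ^ 2 * s ^ 2 ≤ ∑ k ∈ parts t n, (1 - Real.cos (k * θ)) := by
      refine le_trans ?_ hD
      rw [hsθ, mul_pow, ← mul_assoc]
      gcongr
    refine le_trans (Real.exp_le_exp.2 (?_ : _ ≤ -(c * (2 / Real.pi ^ 2 * s ^ 2))))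
      (key (by positivity) ?_ (sq_nonneg s))
    · have := mul_le_mul_of_nonneg_left h1 hc0.le
      linarith
    · have h2 := Real.add_one_le_exp (c * (2 / Real.pi ^ 2 * s ^ 2))
      calc s ^ 2 = Real.pi ^ 2 / (2 * c) * (c * (2 / Real.pi ^ 2 * s ^ 2)) := by field_simp
        _ ≤ _ := mul_le_mul_of_nonneg_left (by linarith) (by positivity)

/-! ### The central and local limit theorems -/

theorem tendsto_cdf (ht : √2 < t) (v : ℝ) :
    Tendsto (fun n : ℕ => (boltzmann t n (param t ht n)).real
        {l | (N l - (n : ℝ)) / sigma t n (param t ht n) ≤ v})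
      atTop (𝓝 ((gaussianReal 0 1).real (Set.Iic v))) := by
  have hprob (n : ℕ) := isProbabilityMeasure_boltzmann t n (param_pos ht n)
  set Y : (n : ℕ) → Part t n → ℝ := fun n l => (N l - (n : ℝ)) / sigma t n (param t ht n) with hY
  have hmeas (n : ℕ) : Measurable (Y n) := Measurable.of_discrete
  set μ : ℕ → ProbabilityMeasure ℝ := fun n =>
    ⟨(boltzmann t n (param t ht n)).map (Y n),
      Measure.isProbabilityMeasure_map (hmeas n).aemeasurable⟩ with hμ
  set γ : ProbabilityMeasure ℝ := ⟨gaussianReal 0 1, inferInstance⟩ with hγ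
  have hlim : Tendsto μ atTop (𝓝 γ) := by
    refine ProbabilityMeasure.tendsto_iff_tendsto_charFun.2 fun s => ?_
    have hγs : charFun (γ : Measure ℝ) s = Complex.exp ((-(s ^ 2 / 2) : ℝ) : ℂ) := by
      rw [hγ, ProbabilityMeasure.coe_mk, charFun_gaussianReal]
      congr 1
      push_cast
      ring
    rw [hγs]
    refine (tendsto_shiftedCF ht s).congr fun n => ?_
    rw [hμ, ProbabilityMeasure.coe_mk, charFun_apply_real,
      integral_map (hmeas n).aemeasurable (by fun_prop), shiftedCF]
    refine integral_congr_ae (.of_forall fun l => ?_)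
    simp only [hY]
    congr 1
    push_cast
    ring
  -- The portmanteau theorem applies because the Gaussian has no atom at `v`.
  have hfr : γ (frontier (Set.Iic v)) = 0 := by
    rw [frontier_Iic, ProbabilityMeasure.null_iff_toMeasure_null]
    have : NullSingletonClass (gaussianReal 0 1) := nullSingletonClass_gaussianReal one_ne_zero
    exact measure_singleton (μ := gaussianReal 0 1) v
  have h := (NNReal.continuous_coe.tendsto _).comp
    (ProbabilityMeasure.tendsto_measure_of_null_frontier_of_tendsto hlim hfr)
  refine h.congr fun n => ?_
  change ((boltzmann t n (param t ht n)).map (Y n)).real (Set.Iic v) = _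
  rw [map_measureReal_apply (hmeas n) measurableSet_Iic]
  rfl

theorem gaussianReal_real_Iic (v : ℝ) : (gaussianReal 0 1).real (Set.Iic v)
    = 1 / √(2 * Real.pi) * ∫ u in Set.Iic v, Real.exp (-(u ^ 2) / 2) := by
  rw [measureReal_def, gaussianReal_apply_eq_integral 0 one_ne_zero, ENNReal.toReal_ofReal
    (integral_nonneg fun u => gaussianPDFReal_nonneg 0 1 u), ← integral_const_mul]
  refine integral_congr_ae (.of_forall fun u => ?_)
  simp [gaussianPDFReal]

theorem tendsto_integral_shiftedCF (ht : √2 < t) :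
    Tendsto (fun n : ℕ => ∫ s in (-(Real.pi * sigma t n (param t ht n)))..
        (Real.pi * sigma t n (param t ht n)),
        shiftedCF t n (param t ht n) (s / sigma t n (param t ht n)))
      atTop (𝓝 ((√(2 * Real.pi) : ℝ) : ℂ)) := by
  obtain ⟨C, hC⟩ := exists_norm_shiftedCF_le ht
  have hgauss : ∫ s : ℝ, Complex.exp ((-(s ^ 2 / 2) : ℝ) : ℂ) = ((√(2 * Real.pi) : ℝ) : ℂ) := by
    simp_rw [← Complex.ofReal_exp]
    rw [integral_complex_ofReal]
    have := integral_gaussian (1 / 2)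
    rw [show Real.pi / (1 / 2) = 2 * Real.pi by ring] at this
    rw [← this]
    congr 2
    funext s
    congr 1
    ring
  rw [← hgauss]
  set σ : ℕ → ℝ := fun n => sigma t n (param t ht n) with hσ
  have hlim : Tendsto (fun n : ℕ => ∫ s : ℝ, (Set.Ioc (-(Real.pi * σ n)) (Real.pi * σ n)).indicator
      (fun s => shiftedCF t n (param t ht n) (s / σ n)) s) atTop
      (𝓝 (∫ s : ℝ, Complex.exp ((-(s ^ 2 / 2) : ℝ) : ℂ))) := by
    -- The indicator places the growing windows on one fixed domain; each `s` is eventually inside,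
    -- as $\sigma_n\to\infty$.
    refine tendsto_integral_filter_of_dominated_convergence (fun s => |C| * (1 + s ^ 2)⁻¹) ?_ ?_ ?_ ?_
    · refine .of_forall fun n => ?_
      have := (continuous_shiftedCF t n (param_pos ht n)).comp (continuous_id.div_const (σ n))
      exact (this.measurable.indicator measurableSet_Ioc).aestronglyMeasurable
    · filter_upwards [eventually_sigma_pos ht] with n hn
      refine .of_forall fun s => ?_
      have hpos : 0 ≤ (1 + s ^ 2)⁻¹ := by positivity
      by_cases hs : s ∈ Set.Ioc (-(Real.pi * σ n)) (Real.pi * σ n)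
      · rw [Set.indicator_of_mem hs]
        exact (hC n hn s (abs_le.2 ⟨hs.1.le, hs.2⟩)).trans
          (mul_le_mul_of_nonneg_right (le_abs_self C) hpos)
      · rw [Set.indicator_of_notMem hs, norm_zero]
        positivity
    · exact integrable_inv_one_add_sq.const_mul _
    · refine .of_forall fun s => (tendsto_shiftedCF ht s).congr' ?_
      filter_upwards [((tendsto_sigma_atTop ht).const_mul_atTop Real.pi_pos).eventually_gt_atTop |s|]
        with n hn
      have := abs_lt.1 hn
      rw [Set.indicator_of_mem (show s ∈ Set.Ioc _ _ from ⟨this.1, this.2.le⟩)]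
  refine hlim.congr fun n => ?_
  have h0 : 0 ≤ Real.pi * σ n := mul_nonneg Real.pi_pos.le (sigma_nonneg n _)
  rw [integral_indicator measurableSet_Ioc, intervalIntegral.integral_of_le (by linarith)]

theorem tendsto_sigma_mul_prob_eq (ht : √2 < t) :
    Tendsto (fun n : ℕ => sigma t n (param t ht n) *
        (boltzmann t n (param t ht n)).real {l | N l = (n : ℝ)})
      atTop (𝓝 (1 / √(2 * Real.pi))) := by
  have h := (Complex.continuous_re.tendsto _).comp (tendsto_integral_shiftedCF ht)
  have h' := h.const_mul (1 / (2 * Real.pi))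
  have hval : 1 / (2 * Real.pi) * ((√(2 * Real.pi) : ℝ) : ℂ).re = 1 / √(2 * Real.pi) := by
    have hpos : 0 < √(2 * Real.pi) := Real.sqrt_pos.2 (by positivity)
    have hsq : √(2 * Real.pi) * √(2 * Real.pi) = 2 * Real.pi :=
      Real.mul_self_sqrt (by positivity)
    rw [Complex.ofReal_re, ← hsq, Real.sqrt_mul_self hpos.le]
    field_simp
  rw [hval] at h'
  refine h'.congr' ?_
  filter_upwards [eventually_sigma_pos ht] with n hn
  have hne := hn.ne'
  simp only [Function.comp]
  -- Undoing $\theta=s/\sigma_n$ produces the factor $\sigma_n$ and the full period $[-\pi,\pi]$.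
  rw [intervalIntegral.integral_comp_div (fun θ => shiftedCF t n (param t ht n) θ) hne, neg_div,
    mul_div_cancel_right₀ _ hne, integral_shiftedCF t n (param_pos ht n), Complex.real_smul,
    ← Complex.ofReal_mul, Complex.ofReal_re]
  have := Real.pi_pos.ne'
  field_simp

end DistinctParts

end

theorem proposition3p3 (t : ℝ) (ht : √2 < t) :
    (∀ v : ℝ,
      Tendsto
        (fun n : ℕ =>
          (DistinctParts.boltzmann t n (DistinctParts.param t ht n)).real
            {l | (DistinctParts.N l - (n : ℝ)) /
                DistinctParts.sigma t n (DistinctParts.param t ht n) ≤ v})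
        atTop
        (𝓝 (1 / √(2 * Real.pi) * ∫ u in Set.Iic v, Real.exp (-(u ^ 2) / 2)))) ∧
    Asymptotics.IsEquivalent atTop
      (fun n : ℕ =>
        (DistinctParts.boltzmann t n (DistinctParts.param t ht n)).real
          {l | DistinctParts.N l = (n : ℝ)})
      (fun n : ℕ =>
        1 / (√(2 * Real.pi) * DistinctParts.sigma t n (DistinctParts.param t ht n))) := by
  have hpos : 0 < √(2 * Real.pi) := Real.sqrt_pos.2 (by positivity)
  refine ⟨fun v => ?_, ?_⟩
  · rw [← DistinctParts.gaussianReal_real_Iic]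
    exact DistinctParts.tendsto_cdf ht v
  · refine (Asymptotics.isEquivalent_iff_tendsto_one ?_).2 ?_
    · filter_upwards [DistinctParts.eventually_sigma_pos ht] with n hn
      positivity
    · have h := (DistinctParts.tendsto_sigma_mul_prob_eq ht).const_mul √(2 * Real.pi)
      rw [mul_one_div_cancel hpos.ne'] at h
      refine h.congr fun n => ?_
      simp only [Pi.div_apply]
      rw [div_div_eq_mul_div, div_one]
      ring
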